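/- Let $p\ge 1$, $\mathcal P=\{1,\dots,p\}$, $\lambda>0$, $\eta\ge 0$, and let $\bar x_j>0$, $\mathcal X_j=[0,\bar x_j]$ for $j\in\mathcal P$, $\mathcal X=\mathcal X_1\times\dots\times\mathcal X_p$. Let $f_j,u_j:[0,\infty)\to\mathbb R$ (outflow functions and information maps), put $\bar f_j=f_j(\bar x_j)$, and consider the coupled density–logit routing dynamics $$\dot x_j=-f_j(x_j)+\lambda r_j,\qquad \dot r_j=-r_j+\frac{e^{-\eta u_j(x_j)}}{\sum_{i=1}^p e^{-\eta u_i(x_i)}},\qquad j\in\mathcal P,$$ where for negative arguments $f_j$ and $u_j$ are extended by their values at $0$ (so that $x\ge 0$ is not imposed but follows). Assume: (a) for each $j$, $f_j(0)=0$, $f_j$ is Lipschitz continuous on $[0,\bar x_j+\varepsilon]$ for some $\varepsilon>0$, and $f_j$ is $\mu_j$-strongly monotone on $\mathcal X_j$: $\mu_j>0$ and $(y-y')(f_j(y)-f_j(y'))\ge\mu_j(y-y')^2$ for all $y,y'\in\mathcal X_j$; (b) for each $j$, $u_j$ (as a function on $[0,\infty)$) is differentiable at every point of $\mathcal X_j$,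 with derivative continuous on $\mathcal X_j$ and $|u_j'|\le\ell_j$ on $\mathcal X_j$, where $\ell_j\ge 0$; (c) $\underline u_j\le u_j\le\bar u_j$ on $\mathcal X_j$ for each $j$, and $\lambda\le\bar f_j\,e^{\eta\underline u_j}\sum_{i\in\mathcal P}e^{-\eta\bar u_i}$ for all $j\in\mathcal P$; (d) $\ell_M<\dfrac{2\mu_m}{\lambda\eta}$, where $\ell_M=\max_j\ell_j$ and $\mu_m=\min_j\mu_j$ (i.e. $\lambda\eta\,\ell_M<2\mu_m$; no condition if $\eta=0$). Let $\mathcal R=\{r\in\mathbb R_{\ge0}^p:\sum_j r_j=1\}$ and $\mathcal R'=\{r\in\mathcal R: r_j\le\bar f_j/\lambda\ \text{for all } j\}$. Then the dynamics have exactly one equilibrium $(x^{\mathrm{eq}},r^{\mathrm{eq}})$ in $\mathcal X\times\mathcal R$, and it lies in $\mathcal X\times\mathcal R'$. Every solution, on $[0,\infty)$ or on an interval $[0,T)$, with $(x(0),r(0))\in\mathcal X\times\mathcal R'$ remains in $\mathcal X\times\mathcal R'$; and every such solution on $[0,\infty)$ satisfies $(x(t),r(t))\to(x^{\mathrm{eq}},r^{\mathrm{eq}})$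 as $t\to\infty$. -/

import Mathlib

/-- The free-flow region `X = X₁ × ⋯ × X_p` with `X_j = [0, x̄_j]`. -/
def freeFlow {p : ℕ} (xbar : Fin p → ℝ) : Set (Fin p → ℝ) :=
  {x | ∀ j, x j ∈ Set.Icc 0 (xbar j)}

/-- The set `R' = {r ∈ R | r ≤ f̄ / λ}`, where `R` is the probability simplex and
`f̄_j = f_j (x̄_j)` is the critical flow. -/
def admissibleRouting {p : ℕ} (lam : ℝ) (f : Fin p → ℝ → ℝ) (xbar : Fin p → ℝ) :
    Set (Fin p → ℝ) :=
  {r | r ∈ stdSimplex ℝ (Fin p) ∧ ∀ j, r j ≤ f j (xbar j) / lam}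

/-- The logit (softmax) map `σ_j(z) = exp(-η z_j) / ∑ i, exp(-η z_i)`. -/
noncomputable def logitChoice {p : ℕ} (eta : ℝ) (z : Fin p → ℝ) (j : Fin p) : ℝ :=
  Real.exp (-eta * z j) / ∑ i, Real.exp (-eta * z i)

/-- Right-hand side of the density equation, `-f_j(x_j) + λ r_j`. The outflow has domain `[0, ∞)`;
for a negative argument the value at `0` is used, so that the sign of `x_j` need not be prescribed
in the notion of a solution (for `0 ≤ x_j` this is literally `-f_j(x_j) + λ r_j`). -/
noncomputable def densityRate {p : ℕ} (lam : ℝ) (f : Fin p → ℝ → ℝ) (x r : Fin p → ℝ)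
    (j : Fin p) : ℝ :=
  -f j (max (x j) 0) + lam * r j

/-- Right-hand side of the routing equation, `-r_j + σ_j(u_1(x_1), …, u_p(x_p))`. The information
maps have domain `[0, ∞)`; negative arguments are treated as in `densityRate`. -/
noncomputable def routingRate {p : ℕ} (eta : ℝ) (u : Fin p → ℝ → ℝ) (x r : Fin p → ℝ)
    (j : Fin p) : ℝ :=
  -r j + logitChoice eta (fun i => u i (max (x i) 0)) j

/-- `(x, r)` is a (classical) solution of the coupled density-routing dynamics on the
time interval `J`. -/
def IsSolutionOn {p : ℕ} (lam eta : ℝ) (f u : Fin p → ℝ → ℝ) (J : Set ℝ)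
    (x r : ℝ → Fin p → ℝ) : Prop :=
  ∀ t ∈ J, ∀ j,
    HasDerivWithinAt (fun s => x s j) (densityRate lam f (x t) (r t) j) J t ∧
    HasDerivWithinAt (fun s => r s j) (routingRate eta u (x t) (r t) j) J t

/-- `(x, r)` is an equilibrium of the coupled density-routing dynamics. -/
def IsEquilibrium {p : ℕ} (lam eta : ℝ) (f u : Fin p → ℝ → ℝ) (x r : Fin p → ℝ) : Prop :=
  ∀ j, densityRate lam f x r j = 0 ∧ routingRate eta u x r j = 0

/-- The assumption on one outflow function `g : [0, ∞) → ℝ` with critical density `b`: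
`g` is Lipschitz continuous near `[0, b]` (relative to `[0, ∞)`), `m`-strongly monotone on `[0, b]`
with `0 < m`, and `g 0 = 0`. -/
def OutflowAssumption (g : ℝ → ℝ) (b m : ℝ) : Prop :=
  (∃ ε > 0, ∃ K : NNReal, LipschitzOnWith K g (Set.Icc 0 (b + ε))) ∧
  0 < m ∧
  (∀ y ∈ Set.Icc 0 b, ∀ z ∈ Set.Icc 0 b, m * (y - z) ^ 2 ≤ (y - z) * (g y - g z)) ∧
  g 0 = 0

/-- The assumption on one information map `v : [0, ∞) → ℝ` with critical density `b`: as a function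
on `[0, ∞)` it is differentiable at every point of `[0, b]`, and its derivative is continuous and
bounded by `l` in absolute value on `[0, b]`. -/
def InformationAssumption (v : ℝ → ℝ) (b l : ℝ) : Prop :=
  (∀ y ∈ Set.Icc 0 b, DifferentiableWithinAt ℝ v (Set.Ici 0) y) ∧
  ContinuousOn (derivWithin v (Set.Ici 0)) (Set.Icc 0 b) ∧
  0 ≤ l ∧
  ∀ y ∈ Set.Icc 0 b, |derivWithin v (Set.Ici 0) y| ≤ l

/-! With `w` the logit weights, the Jacobian of the logit map is `-η (diag w - w wᵀ)`, and `diag w -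
w wᵀ` has Euclidean operator norm at most `1/2`. So the logit map is `η/2`-Lipschitz in the
Euclidean norm (`sum_sq_logitChoice_sub_le`), and on the box `x ↦ σ(u(x))` is `ηL/2`-Lipschitz, `L`
bounding the slopes of the information maps.

Equilibria are the fixed points of `x ↦ f⁻¹(λ σ(u(x)))`. The bound on `λ` makes this a self-map of
the box (`lam_mul_logitChoice_le`). Strong monotonicity makes `f⁻¹` `1/m`-Lipschitz, so the map
contracts with factor `ληL/(2m) < 1`, and Banach's theorem applies.

Invariance: the squared violation `V` of the upper bounds starts at `0` and satisfies `V' ≤ C V`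
while `x` stays near the box (`IsSolutionOn.upper_bounds_of_near`). Grönwall keeps it at `0`, and
continuous induction covers the whole interval.

Convergence: `κ|x - xeq|² + λ|r - req|²` decays exponentially for any `κ` strictly between `ηL/2`
and `m/λ`; the stability condition says that this gap is nonempty. -/

/-! ### Covariance bounds and the Lipschitz constant of the logit map. -/

/-- Twice the variance is `∑ w_i w_j (v_i - v_j)²`. Bounding the off-diagonal squares by `2v_i² +
2v_j²` leaves `∑ 4 w_i (1 - w_i) v_i²`, and `4w(1 - w) ≤ 1`. Equality holds for two equal weights
and `v = (1, -1)`. -/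
theorem variance_le_half_sum_sq {ι : Type*} [Fintype ι] {w : ι → ℝ} (hw : ∀ i, 0 ≤ w i)
    (hw1 : ∑ i, w i = 1) (v : ι → ℝ) :
    ∑ i, w i * v i ^ 2 - (∑ i, w i * v i) ^ 2 ≤ (∑ i, v i ^ 2) / 2 := by
  classical
  have h1 : ∑ i, ∑ j, w i * w j * (v i - v j) ^ 2 ≤
      ∑ i, ∑ j, (w i * w j * (2 * v i ^ 2 + 2 * v j ^ 2) -
        if i = j then 4 * w i ^ 2 * v i ^ 2 else 0) := by
    refine Finset.sum_le_sum fun i _ => Finset.sum_le_sum fun j _ => ?_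
    split_ifs with h
    · subst h
      exact le_of_eq (by ring)
    · nlinarith [mul_nonneg (mul_nonneg (hw i) (hw j)) (sq_nonneg (v i + v j))]
  have h2 : ∑ i, ∑ j, w i * w j * (v i - v j) ^ 2 =
      2 * (∑ i, w i * v i ^ 2 - (∑ i, w i * v i) ^ 2) := by
    have : ∀ i j, w i * w j * (v i - v j) ^ 2 =
        (w i * v i ^ 2) * w j + w i * (w j * v j ^ 2) - 2 * ((w i * v i) * (w j * v j)) :=
      fun i j => by ring
    simp_rw [this, Finset.sum_sub_distrib, Finset.sum_add_distrib, ← Finset.mul_sum,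
      ← Finset.sum_mul, hw1]
    ring
  have h3 : ∑ i, ∑ j, (w i * w j * (2 * v i ^ 2 + 2 * v j ^ 2) -
        if i = j then 4 * w i ^ 2 * v i ^ 2 else 0) = ∑ i, 4 * (w i * (1 - w i)) * v i ^ 2 := by
    have : ∀ i j, w i * w j * (2 * v i ^ 2 + 2 * v j ^ 2) =
        2 * ((w i * v i ^ 2) * w j) + 2 * (w i * (w j * v j ^ 2)) := fun i j => by ring
    simp_rw [this, Finset.sum_sub_distrib, Finset.sum_add_distrib, Finset.sum_ite_eq,
      Finset.mem_univ, if_true, ← Finset.mul_sum, ← Finset.sum_mul, hw1]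
    have : ∀ i, 4 * (w i * (1 - w i)) * v i ^ 2 = 4 * (w i * v i ^ 2) - 4 * w i ^ 2 * v i ^ 2 :=
      fun i => by ring
    simp_rw [this, Finset.sum_sub_distrib, ← Finset.mul_sum]
    ring
  have h4 : ∑ i, 4 * (w i * (1 - w i)) * v i ^ 2 ≤ ∑ i, v i ^ 2 := by
    refine Finset.sum_le_sum fun i _ => ?_
    have : 4 * (w i * (1 - w i)) ≤ 1 := by nlinarith [sq_nonneg (2 * w i - 1)]
    nlinarith [mul_le_mul_of_nonneg_right this (sq_nonneg (v i))]
  linarith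

/-- The left side is the covariance of `a` and `c`. Since the variance of `a - c` is nonnegative, it
is at most the mean of the two variances. -/
theorem covariance_le_quarter_sum_sq {ι : Type*} [Fintype ι] {w : ι → ℝ} (hw : ∀ i, 0 ≤ w i)
    (hw1 : ∑ i, w i = 1) (a c : ι → ℝ) :
    ∑ i, a i * (w i * (c i - ∑ k, w k * c k)) ≤ (∑ i, a i ^ 2 + ∑ i, c i ^ 2) / 4 := by
  have ha := variance_le_half_sum_sq hw hw1 a
  have hc := variance_le_half_sum_sq hw hw1 c
  set A := ∑ i, w i * a i with hA
  set C := ∑ i, w i * c i with hC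
  have h0 : 0 ≤ ∑ i, w i * ((a i - A) - (c i - C)) ^ 2 :=
    Finset.sum_nonneg fun i _ => mul_nonneg (hw i) (sq_nonneg _)
  have h1 : ∑ i, w i * ((a i - A) - (c i - C)) ^ 2 =
      (∑ i, w i * a i ^ 2 - A ^ 2) + (∑ i, w i * c i ^ 2 - C ^ 2) -
        2 * ∑ i, a i * (w i * (c i - C)) := by
    have e : ∀ i, w i * ((a i - A) - (c i - C)) ^ 2 = w i * a i ^ 2 + w i * c i ^ 2
        - 2 * (a i * (w i * (c i - C))) - 2 * A * (w i * a i) + 2 * A * (w i * c i)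
        + (A ^ 2 - 2 * A * C + C ^ 2) * w i - 2 * C * (w i * c i) := fun i => by ring
    simp_rw [e, Finset.sum_sub_distrib, Finset.sum_add_distrib, Finset.sum_sub_distrib,
      Finset.sum_add_distrib, ← Finset.mul_sum, ← hA, ← hC, hw1]
    ring
  linarith

section logit

variable {p : ℕ} [NeZero p] (eta : ℝ)

theorem sum_exp_pos (z : Fin p → ℝ) : 0 < ∑ i, Real.exp (-eta * z i) :=
  Finset.sum_pos (fun _ _ => Real.exp_pos _) Finset.univ_nonempty

theorem logitChoice_pos (z : Fin p → ℝ) (j : Fin p) : 0 < logitChoice eta z j :=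
  div_pos (Real.exp_pos _) (sum_exp_pos eta z)

theorem sum_logitChoice (z : Fin p → ℝ) : ∑ j, logitChoice eta z j = 1 := by
  simp only [logitChoice, ← Finset.sum_div]
  exact div_self (sum_exp_pos eta z).ne'

theorem hasDerivAt_logitChoice_line (z d : Fin p → ℝ) (j : Fin p) (s : ℝ) :
    HasDerivAt (fun s : ℝ => logitChoice eta (fun i => z i + s * d i) j)
      (logitChoice eta (fun i => z i + s * d i) j *
        (-eta * d j - ∑ k, logitChoice eta (fun i => z i + s * d i) k * (-eta * d k))) s := by
  have hE : ∀ i, HasDerivAt (fun s : ℝ => Real.exp (-eta * (z i + s * d i)))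
      (Real.exp (-eta * (z i + s * d i)) * (-eta * d i)) s := fun i => by
    have := ((((hasDerivAt_id s).mul_const (d i)).const_add (z i)).const_mul (-eta)).exp
    simpa using this
  have hS := sum_exp_pos eta (fun i => z i + s * d i)
  have h := (hE j).fun_div (HasDerivAt.fun_sum fun i (_ : i ∈ Finset.univ) => hE i) hS.ne'
  refine h.congr_deriv ?_
  simp only [logitChoice, div_mul_eq_mul_div, ← Finset.sum_div]
  field_simp

/-- Mean value theorem for `s ↦ ⟨2D, σ(z + s d)⟩` on `[0, 1]`. The slope is `2|D|²` and the
derivative, a covariance, is at most `|D|² + η²|d|²/4`; the factor `2` is the one giving the best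
constant after absorbing `|D|²`. -/
theorem sum_sq_logitChoice_sub_le (z z' : Fin p → ℝ) :
    ∑ j, (logitChoice eta z' j - logitChoice eta z j) ^ 2 ≤
      eta ^ 2 / 4 * ∑ j, (z' j - z j) ^ 2 := by
  set D : Fin p → ℝ := fun j => logitChoice eta z' j - logitChoice eta z j with hD
  set d : Fin p → ℝ := fun j => z' j - z j with hd
  have hder : ∀ s : ℝ, HasDerivAt
      (fun s : ℝ => ∑ j, (2 * D j) * logitChoice eta (fun i => z i + s * d i) j) _ s := fun s =>
    HasDerivAt.fun_sum fun j (_ : j ∈ Finset.univ) =>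
      (hasDerivAt_logitChoice_line eta z d j s).const_mul (2 * D j)
  obtain ⟨s, -, hs⟩ := exists_hasDerivAt_eq_slope _ _ (zero_lt_one (α := ℝ))
    (fun s _ => (hder s).continuousAt.continuousWithinAt) (fun s _ => hder s)
  have hb := covariance_le_quarter_sum_sq
    (fun j => (logitChoice_pos eta (fun i => z i + s * d i) j).le)
    (sum_logitChoice eta _) (fun j => 2 * D j) (fun j => -eta * d j)
  rw [hs] at hb
  have e1 : (fun i => z i + 1 * d i) = z' := by funext i; simp [hd]
  have e0 : (fun i => z i + 0 * d i) = z := by funext i; simp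
  rw [e1, e0, ← Finset.sum_sub_distrib] at hb
  have e2 : ∀ j, 2 * D j * logitChoice eta z' j - 2 * D j * logitChoice eta z j
      = 2 * D j ^ 2 := fun j => by simp only [hD]; ring
  simp_rw [e2, mul_pow, ← Finset.mul_sum] at hb
  norm_num at hb
  linarith

end logit

/-! ### Grönwall's inequality and consequences of the assumptions on `f` and `u`. -/

/-- Grönwall's inequality for a scalar function on an interval. -/
theorem le_mul_exp_of_hasDerivWithinAt_le {J : Set ℝ} (hJ : Convex ℝ J) {V V' : ℝ → ℝ} {c : ℝ}
    (hV : ∀ t ∈ J, HasDerivWithinAt V (V' t) J t) (hc : ∀ t ∈ J, V' t ≤ c * V t)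
    {s t : ℝ} (hs : s ∈ J) (ht : t ∈ J) (hst : s ≤ t) :
    V t ≤ V s * Real.exp (c * (t - s)) := by
  have hd : ∀ t ∈ J, HasDerivWithinAt (fun t => V t * Real.exp (-c * t))
      ((V' t - c * V t) * Real.exp (-c * t)) J t := fun t ht => by
    have h1 : HasDerivAt (fun t : ℝ => Real.exp (-c * t)) (Real.exp (-c * t) * (-c)) t := by
      simpa using ((hasDerivAt_id t).const_mul (-c)).exp
    exact ((hV t ht).fun_mul h1.hasDerivWithinAt).congr_deriv (by ring)
  have hanti := antitoneOn_of_hasDerivWithinAt_nonpos hJ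
    (fun t ht => (hd t ht).continuousWithinAt)
    (fun t ht => (hd t (interior_subset ht)).mono interior_subset)
    (fun t ht => mul_nonpos_of_nonpos_of_nonneg (by linarith [hc t (interior_subset ht)])
      (Real.exp_pos _).le) hs ht hst
  have h2 := mul_le_mul_of_nonneg_right hanti (Real.exp_pos (c * t)).le
  simp only [mul_assoc, ← Real.exp_add] at h2
  have e1 : -c * t + c * t = 0 := by ring
  have e2 : -c * s + c * t = c * (t - s) := by ring
  rwa [e1, e2, Real.exp_zero, mul_one] at h2

/-- Squaring removes the kink of the positive part, so violations of a bound can be fed to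
Grönwall's inequality. -/
theorem hasDerivAt_sq_posPart (a : ℝ) :
    HasDerivAt (fun a : ℝ => max a 0 ^ 2) (2 * max a 0) a := by
  rcases lt_trichotomy a 0 with h | rfl | h
  · rw [max_eq_right h.le, mul_zero]
    refine (hasDerivAt_const a (0 : ℝ)).congr_of_eventuallyEq ?_
    filter_upwards [gt_mem_nhds h] with y hy
    simp [max_eq_right (le_of_lt hy)]
  · rw [hasDerivAt_iff_isLittleO_nhds_zero]
    have h1 : (fun h : ℝ => h ^ 2) =o[nhds 0] fun h => h := by
      simpa using Asymptotics.isLittleO_pow_id (𝕜 := ℝ) one_lt_two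
    refine (Asymptotics.IsBigO.of_bound 1 (Filter.Eventually.of_forall fun h => ?_)).trans_isLittleO
      h1
    simp only [zero_add, max_self, smul_eq_mul, mul_zero, sub_zero, ne_eq, OfNat.ofNat_ne_zero,
      not_false_eq_true, zero_pow, norm_pow, one_mul]
    refine pow_le_pow_left₀ (norm_nonneg _) ?_ 2
    rw [Real.norm_eq_abs, Real.norm_eq_abs, abs_of_nonneg (le_max_right _ _)]
    exact max_le (le_abs_self _) (abs_nonneg _)
  · rw [max_eq_left h.le]
    refine ((hasDerivAt_pow 2 a).congr_deriv (by simp)).congr_of_eventuallyEq ?_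
    filter_upwards [lt_mem_nhds h] with y hy
    simp [max_eq_left (le_of_lt hy)]

theorem InformationAssumption.abs_sub_le {v : ℝ → ℝ} {b l : ℝ} (h : InformationAssumption v b l)
    {y z : ℝ} (hy : y ∈ Set.Icc 0 b) (hz : z ∈ Set.Icc 0 b) : |v y - v z| ≤ l * |y - z| :=
  (convex_Icc 0 b).norm_image_sub_le_of_norm_hasDerivWithin_le
    (fun x hx => (h.1 x hx).hasDerivWithinAt.mono Set.Icc_subset_Ici_self)
    (fun x hx => h.2.2.2 x hx) hz hy

/-- Beyond `b` nothing is known about `v` except through its derivative at `b`, so only increments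
based at `b` are controlled. This suffices for invariance. -/
theorem InformationAssumption.exists_linear_bound {v : ℝ → ℝ} {b l : ℝ}
    (h : InformationAssumption v b l) (hb : 0 < b) :
    ∃ ε > 0, ∃ K ≥ 0, ∀ y, b ≤ y → y ≤ b + ε → |v y - v b| ≤ K * (y - b) := by
  have hd : DifferentiableAt ℝ v b :=
    (h.1 b ⟨hb.le, le_rfl⟩).differentiableAt (Ici_mem_nhds hb)
  obtain ⟨K, hK, hO⟩ := hd.isBigO_sub.exists_nonneg
  obtain ⟨ε, hε, hball⟩ := Metric.eventually_nhds_iff.1 hO.bound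
  refine ⟨ε / 2, half_pos hε, K, hK, fun y hy hy' => ?_⟩
  have : dist y b < ε := by
    rw [Real.dist_eq, abs_of_nonneg (by linarith)]
    linarith
  simpa [Real.norm_eq_abs, abs_of_nonneg (sub_nonneg.2 hy)] using hball this

theorem OutflowAssumption.exists_linear_bound {g : ℝ → ℝ} {b m : ℝ}
    (h : OutflowAssumption g b m) (hb : 0 < b) :
    ∃ ε > 0, ∃ K ≥ 0, ∀ y, b ≤ y → y ≤ b + ε → |g y - g b| ≤ K * (y - b) := by
  obtain ⟨⟨ε, hε, K, hK⟩, -⟩ := h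
  refine ⟨ε, hε, K, K.2, fun y hy hy' => ?_⟩
  have := hK.dist_le_mul y ⟨by linarith, hy'⟩ b ⟨hb.le, by linarith⟩
  rwa [Real.dist_eq, Real.dist_eq, abs_of_nonneg (sub_nonneg.2 hy)] at this

theorem OutflowAssumption.mul_abs_sub_le {g : ℝ → ℝ} {b m : ℝ} (h : OutflowAssumption g b m)
    {y z : ℝ} (hy : y ∈ Set.Icc 0 b) (hz : z ∈ Set.Icc 0 b) : m * |y - z| ≤ |g y - g z| := by
  rcases eq_or_ne y z with rfl | hne
  · simp
  have h1 := h.2.2.1 y hy z hz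
  have h2 : 0 < |y - z| := abs_pos.2 (sub_ne_zero.2 hne)
  have h3 := (le_abs_self _).trans_eq (abs_mul (y - z) (g y - g z))
  rw [← sq_abs] at h1
  refine le_of_mul_le_mul_left ?_ h2
  nlinarith

theorem OutflowAssumption.surjOn {g : ℝ → ℝ} {b m : ℝ} (h : OutflowAssumption g b m)
    (hb : 0 < b) : Set.SurjOn g (Set.Icc 0 b) (Set.Icc 0 (g b)) := by
  obtain ⟨⟨ε, hε, K, hK⟩, -, -, h0⟩ := h
  have := intermediate_value_Icc hb.le
    (hK.continuousOn.mono (Set.Icc_subset_Icc_right (by linarith : b ≤ b + ε)))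
  rwa [h0] at this

/-! ### Existence and uniqueness of the equilibrium. -/

section

variable {p : ℕ} {lam eta : ℝ} {xbar : Fin p → ℝ} {f u : Fin p → ℝ → ℝ}
  {mu l ulow uhigh : Fin p → ℝ} {L m : ℝ}

theorem max_zero_of_mem_freeFlow {x : Fin p → ℝ} (hx : x ∈ freeFlow xbar) (j : Fin p) :
    max (x j) 0 = x j :=
  max_eq_left (hx j).1

/-- The strong monotonicity constant controls the density by the outflow. -/
theorem sq_mul_sum_sq_sub_le (hf : ∀ j, OutflowAssumption (f j) (xbar j) (mu j)) (hm0 : 0 ≤ m)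
    (hm : ∀ j, m ≤ mu j) {x y : Fin p → ℝ} (hx : x ∈ freeFlow xbar) (hy : y ∈ freeFlow xbar) :
    m ^ 2 * ∑ j, (x j - y j) ^ 2 ≤ ∑ j, (f j (x j) - f j (y j)) ^ 2 := by
  rw [Finset.mul_sum]
  refine Finset.sum_le_sum fun j _ => ?_
  rw [← mul_pow]
  refine sq_le_sq.2 (le_trans ?_ ((hf j).mul_abs_sub_le (hx j) (hy j)))
  rw [abs_mul, abs_of_nonneg hm0]
  exact mul_le_mul_of_nonneg_right (hm j) (abs_nonneg _)

theorem isEquilibrium_iff_of_mem_freeFlow {x r : Fin p → ℝ} (hx : x ∈ freeFlow xbar) :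
    IsEquilibrium lam eta f u x r ↔
      ∀ j, f j (x j) = lam * r j ∧ r j = logitChoice eta (fun i => u i (x i)) j := by
  simp only [IsEquilibrium, densityRate, routingRate, max_zero_of_mem_freeFlow hx]
  refine forall_congr' fun j => ?_
  constructor <;> rintro ⟨h1, h2⟩ <;> constructor <;> linarith

variable [NeZero p]

/-- The worst case over the box puts `ulow j` in the numerator and every `uhigh i` in the
denominator, which is the case that `hexist` covers. -/
theorem lam_mul_logitChoice_le (heta : 0 ≤ eta) (hlam : 0 < lam)
    (hbounds : ∀ j, ∀ y ∈ Set.Icc 0 (xbar j), ulow j ≤ u j y ∧ u j y ≤ uhigh j)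
    (hexist : ∀ j, lam ≤
      f j (xbar j) * Real.exp (eta * ulow j) * ∑ i, Real.exp (-eta * uhigh i))
    {x : Fin p → ℝ} (hx : x ∈ freeFlow xbar) (j : Fin p) :
    lam * logitChoice eta (fun i => u i (x i)) j ≤ f j (xbar j) := by
  have hS : ∑ i, Real.exp (-eta * uhigh i) ≤ ∑ i, Real.exp (-eta * u i (x i)) :=
    Finset.sum_le_sum fun i _ => Real.exp_le_exp.2
      (by nlinarith [mul_le_mul_of_nonneg_left (hbounds i _ (hx i)).2 heta])
  have hS0 := sum_exp_pos eta uhigh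
  have hS1 := sum_exp_pos eta (fun i => u i (x i))
  have hF : 0 ≤ f j (xbar j) := by
    by_contra! hneg
    have := hexist j
    have h1 : f j (xbar j) * (Real.exp (eta * ulow j) * ∑ i, Real.exp (-eta * uhigh i)) < 0 :=
      mul_neg_of_neg_of_pos hneg (mul_pos (Real.exp_pos _) hS0)
    linarith
  have hE : Real.exp (-eta * u j (x j)) * Real.exp (eta * ulow j) ≤ 1 := by
    rw [← Real.exp_add, Real.exp_le_one_iff]
    nlinarith [mul_le_mul_of_nonneg_left (hbounds j _ (hx j)).1 heta]
  rw [logitChoice, ← mul_div_assoc, div_le_iff₀ hS1]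
  calc lam * Real.exp (-eta * u j (x j))
      ≤ (f j (xbar j) * Real.exp (eta * ulow j) * ∑ i, Real.exp (-eta * uhigh i)) *
          Real.exp (-eta * u j (x j)) :=
        mul_le_mul_of_nonneg_right (hexist j) (Real.exp_pos _).le
    _ = f j (xbar j) * (∑ i, Real.exp (-eta * uhigh i)) *
          (Real.exp (-eta * u j (x j)) * Real.exp (eta * ulow j)) := by ring
    _ ≤ f j (xbar j) * (∑ i, Real.exp (-eta * uhigh i)) * 1 :=
        mul_le_mul_of_nonneg_left hE (mul_nonneg hF hS0.le)
    _ ≤ f j (xbar j) * ∑ i, Real.exp (-eta * u i (x i)) := by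
        rw [mul_one]
        exact mul_le_mul_of_nonneg_left hS hF

theorem sum_sq_logitChoice_info_sub_le (hu : ∀ j, InformationAssumption (u j) (xbar j) (l j))
    (hl : ∀ j, l j ≤ L) {x y : Fin p → ℝ} (hx : x ∈ freeFlow xbar) (hy : y ∈ freeFlow xbar) :
    ∑ j, (logitChoice eta (fun i => u i (x i)) j - logitChoice eta (fun i => u i (y i)) j) ^ 2 ≤
      (eta * L / 2) ^ 2 * ∑ j, (x j - y j) ^ 2 := by
  refine (sum_sq_logitChoice_sub_le eta _ _).trans ?_
  rw [show (eta * L / 2) ^ 2 = eta ^ 2 / 4 * L ^ 2 by ring, mul_assoc]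
  refine mul_le_mul_of_nonneg_left ?_ (by positivity)
  rw [Finset.mul_sum]
  refine Finset.sum_le_sum fun j _ => ?_
  rw [← mul_pow]
  refine sq_le_sq.2 (((hu j).abs_sub_le (hx j) (hy j)).trans ?_)
  rw [abs_mul]
  exact mul_le_mul_of_nonneg_right ((hl j).trans (le_abs_self L)) (abs_nonneg _)

/-- Two density vectors whose outflows are the logit responses of density vectors. -/
theorem sq_mul_sum_sq_sub_le_of_outflow_eq (hf : ∀ j, OutflowAssumption (f j) (xbar j) (mu j))
    (hu : ∀ j, InformationAssumption (u j) (xbar j) (l j)) (hm0 : 0 ≤ m)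
    (hm : ∀ j, m ≤ mu j) (hl : ∀ j, l j ≤ L) {x y x' y' : Fin p → ℝ} (hx : x ∈ freeFlow xbar)
    (hy : y ∈ freeFlow xbar) (hx' : x' ∈ freeFlow xbar) (hy' : y' ∈ freeFlow xbar)
    (hxx : ∀ j, f j (x' j) = lam * logitChoice eta (fun i => u i (x i)) j)
    (hyy : ∀ j, f j (y' j) = lam * logitChoice eta (fun i => u i (y i)) j) :
    m ^ 2 * ∑ j, (x' j - y' j) ^ 2 ≤ (lam * eta * L / 2) ^ 2 * ∑ j, (x j - y j) ^ 2 := by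
  refine (sq_mul_sum_sq_sub_le hf hm0 hm hx' hy').trans ?_
  simp_rw [hxx, hyy, ← mul_sub, mul_pow, ← Finset.mul_sum]
  refine (mul_le_mul_of_nonneg_left (sum_sq_logitChoice_info_sub_le hu hl hx hy)
    (sq_nonneg lam)).trans_eq (by ring)

theorem IsEquilibrium.unique (hf : ∀ j, OutflowAssumption (f j) (xbar j) (mu j))
    (hu : ∀ j, InformationAssumption (u j) (xbar j) (l j)) (hm : ∀ j, m ≤ mu j)
    (hl : ∀ j, l j ≤ L) (hpos : 0 ≤ lam * eta * L) (hstab : lam * eta * L < 2 * m)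
    {x r y s : Fin p → ℝ} (hx : x ∈ freeFlow xbar) (hy : y ∈ freeFlow xbar)
    (hxr : IsEquilibrium lam eta f u x r) (hys : IsEquilibrium lam eta f u y s) :
    y = x ∧ s = r := by
  rw [isEquilibrium_iff_of_mem_freeFlow hx] at hxr
  rw [isEquilibrium_iff_of_mem_freeFlow hy] at hys
  have h := sq_mul_sum_sq_sub_le_of_outflow_eq (lam := lam) (eta := eta) hf hu (by linarith) hm hl
    hy hx hy hx
    (fun j => (hys j).2 ▸ (hys j).1) (fun j => (hxr j).2 ▸ (hxr j).1)
  have hlt : (lam * eta * L / 2) ^ 2 < m ^ 2 :=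
    pow_lt_pow_left₀ (by linarith) (by linarith) two_ne_zero
  have h0 : 0 ≤ ∑ j, (y j - x j) ^ 2 := Finset.sum_nonneg fun j _ => sq_nonneg _
  have h1 : ∑ j, (y j - x j) ^ 2 = 0 := by nlinarith
  have hyx : y = x := by
    funext j
    have := (Finset.sum_eq_zero_iff_of_nonneg fun j _ => sq_nonneg _).1 h1 j (Finset.mem_univ j)
    exact sub_eq_zero.1 (pow_eq_zero_iff two_ne_zero |>.1 this)
  subst hyx
  exact ⟨rfl, funext fun j => (hys j).2.trans (hxr j).2.symm⟩

theorem exists_isEquilibrium (hlam : 0 < lam) (heta : 0 ≤ eta) (hxbar : ∀ j, 0 < xbar j)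
    (hf : ∀ j, OutflowAssumption (f j) (xbar j) (mu j))
    (hu : ∀ j, InformationAssumption (u j) (xbar j) (l j))
    (hbounds : ∀ j, ∀ y ∈ Set.Icc 0 (xbar j), ulow j ≤ u j y ∧ u j y ≤ uhigh j)
    (hexist : ∀ j, lam ≤
      f j (xbar j) * Real.exp (eta * ulow j) * ∑ i, Real.exp (-eta * uhigh i))
    (hm : ∀ j, m ≤ mu j)
    (hl : ∀ j, l j ≤ L) (hpos : 0 ≤ lam * eta * L) (hstab : lam * eta * L < 2 * m) :
    ∃ x ∈ freeFlow xbar, ∃ r ∈ admissibleRouting lam f xbar, IsEquilibrium lam eta f u x r := by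
  have hm0 : 0 < m := by linarith
  have hex : ∀ (x : EuclideanSpace ℝ (Fin p)) (j : Fin p), ∃ y,
      x.ofLp ∈ freeFlow xbar → y ∈ Set.Icc 0 (xbar j) ∧
        f j y = lam * logitChoice eta (fun i => u i (x i)) j := fun x j => by
    by_cases hx : x.ofLp ∈ freeFlow xbar
    · obtain ⟨y, hy, hy'⟩ := (hf j).surjOn (hxbar j)
        ⟨mul_nonneg hlam.le (logitChoice_pos eta (fun i => u i (x i)) j).le,
          lam_mul_logitChoice_le heta hlam hbounds hexist hx j⟩
      exact ⟨y, fun _ => ⟨hy, hy'⟩⟩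
    -- Off the box the value is irrelevant.
    · exact ⟨0, fun h => absurd h hx⟩
  choose G hG using hex
  -- The contraction estimate is Euclidean, whereas `Fin p → ℝ` carries the sup metric.
  set Φ : EuclideanSpace ℝ (Fin p) → EuclideanSpace ℝ (Fin p) := fun x => WithLp.toLp 2 (G x)
    with hΦ
  set S : Set (EuclideanSpace ℝ (Fin p)) := {x | x.ofLp ∈ freeFlow xbar} with hS
  have hclosed : IsClosed S := by
    have : S = ⋂ j, (fun x : EuclideanSpace ℝ (Fin p) => x j) ⁻¹' Set.Icc 0 (xbar j) := by
      ext x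
      simp only [hS, freeFlow, Set.mem_ofPred_eq, Set.mem_iInter, Set.mem_preimage]
    rw [this]
    exact isClosed_iInter fun j => isClosed_Icc.preimage (by fun_prop)
  have hmaps : Set.MapsTo Φ S S := fun x hx j => (hG x j hx).1
  have hKnn : 0 ≤ lam * eta * L / (2 * m) := div_nonneg hpos (by linarith)
  have hcontr : ContractingWith (lam * eta * L / (2 * m)).toNNReal (hmaps.restrict Φ S S) := by
    refine ⟨?_, LipschitzWith.of_dist_le_mul fun x y => ?_⟩
    · rw [Real.toNNReal_lt_one]
      exact (div_lt_one (by linarith)).2 hstab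
    · rw [Real.coe_toNNReal _ hKnn, Subtype.dist_eq, Subtype.dist_eq]
      have h := sq_mul_sum_sq_sub_le_of_outflow_eq hf hu hm0.le hm hl x.2 y.2
        (hmaps x.2) (hmaps y.2)
        (fun j => (hG x j x.2).2) (fun j => (hG y j y.2).2)
      have e : ∀ a b : EuclideanSpace ℝ (Fin p), ∑ j, (a j - b j) ^ 2 = dist a b ^ 2 :=
        fun a b => by
          rw [EuclideanSpace.dist_eq, Real.sq_sqrt (Finset.sum_nonneg fun _ _ => sq_nonneg _)]
          simp [Real.dist_eq, sq_abs]
      rw [e, e, ← mul_pow, ← mul_pow] at h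
      have h2 := le_of_sq_le_sq h (by positivity)
      show dist (Φ x) (Φ y) ≤ lam * eta * L / (2 * m) * dist (x : EuclideanSpace ℝ (Fin p)) y
      rw [div_mul_eq_mul_div, le_div_iff₀ (by linarith)]
      linarith
  have h0 : (0 : EuclideanSpace ℝ (Fin p)) ∈ S := fun j => ⟨le_rfl, (hxbar j).le⟩
  obtain ⟨x, hx, hfix, -⟩ :=
    hcontr.exists_fixedPoint' hclosed.isComplete hmaps h0 (edist_ne_top _ _)
  have hxG : ∀ j, G x j = x j := fun j => congrFun (congrArg WithLp.ofLp hfix) j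
  refine ⟨x.ofLp, hx, logitChoice eta (fun i => u i (x i)),
    ⟨⟨fun j => (logitChoice_pos eta _ j).le, sum_logitChoice eta _⟩, fun j => ?_⟩,
    (isEquilibrium_iff_of_mem_freeFlow hx).2 fun j => ⟨?_, rfl⟩⟩
  · rw [le_div_iff₀ hlam, mul_comm]
    exact lam_mul_logitChoice_le heta hlam hbounds hexist hx j
  · rw [← (hG x j hx).2, hxG]

end

/-! ### Invariance of `X × R'`. -/

section

variable {p : ℕ} {lam eta : ℝ} {xbar : Fin p → ℝ} {f u : Fin p → ℝ → ℝ}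
  {mu l ulow uhigh : Fin p → ℝ} {L m : ℝ}

theorem IsSolutionOn.mono {J J' : Set ℝ} {x r : ℝ → Fin p → ℝ}
    (h : IsSolutionOn lam eta f u J x r) (hJ : J' ⊆ J) : IsSolutionOn lam eta f u J' x r :=
  fun t ht j => ⟨(h t (hJ ht) j).1.mono hJ, (h t (hJ ht) j).2.mono hJ⟩

theorem IsSolutionOn.continuousWithinAt_fst {J : Set ℝ} {x r : ℝ → Fin p → ℝ}
    (h : IsSolutionOn lam eta f u J x r) {t : ℝ} (ht : t ∈ J) : ContinuousWithinAt x J t :=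
  continuousWithinAt_pi.2 fun j => (h t ht j).1.continuousWithinAt

theorem IsSolutionOn.continuousWithinAt_snd {J : Set ℝ} {x r : ℝ → Fin p → ℝ}
    (h : IsSolutionOn lam eta f u J x r) {t : ℝ} (ht : t ∈ J) : ContinuousWithinAt r J t :=
  continuousWithinAt_pi.2 fun j => (h t ht j).2.continuousWithinAt

variable [NeZero p]

theorem IsSolutionOn.routing_mem_stdSimplex {J : Set ℝ} (hJ : Convex ℝ J) {x r : ℝ → Fin p → ℝ}
    (h : IsSolutionOn lam eta f u J x r) {s t : ℝ} (hs : s ∈ J) (ht : t ∈ J) (hst : s ≤ t)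
    (hr : r s ∈ stdSimplex ℝ (Fin p)) : r t ∈ stdSimplex ℝ (Fin p) := by
  refine ⟨fun j => ?_, ?_⟩
  · have := le_mul_exp_of_hasDerivWithinAt_le hJ (c := -1) (fun t ht => (h t ht j).2.fun_neg)
      (fun t ht => by
        have := logitChoice_pos eta (fun i => u i (max (x t i) 0)) j
        simp only [routingRate]
        linarith) hs ht hst
    have h1 := mul_nonneg (hr.1 j) (Real.exp_pos (-1 * (t - s))).le
    linarith
  · have hd : ∀ t ∈ J, HasDerivWithinAt (fun t => ∑ j, r t j - 1) (-(∑ j, r t j - 1)) J t :=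
      fun t ht => by
        have := (HasDerivWithinAt.fun_sum fun j (_ : j ∈ Finset.univ) => (h t ht j).2).sub_const 1
        refine this.congr_deriv ?_
        simp only [routingRate, Finset.sum_add_distrib, Finset.sum_neg_distrib, sum_logitChoice]
        ring
    -- The defect `∑ r_j - 1` solves `y' = -y`; Grönwall for both signs keeps it at zero.
    have h1 := le_mul_exp_of_hasDerivWithinAt_le hJ (c := -1) hd
      (fun t _ => by linarith) hs ht hst
    have h2 := le_mul_exp_of_hasDerivWithinAt_le hJ (c := -1) (fun t ht => (hd t ht).fun_neg)
      (fun t _ => by linarith) hs ht hst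
    rw [hr.2] at h1 h2
    simp only [sub_self, neg_zero, zero_mul] at h1 h2
    linarith

/-- Where `x_j ≤ 0`, the extended outflow is `f_j(0) = 0` and `x_j' = λ r_j ≥ 0`, so the squared
negative part cannot grow. -/
theorem IsSolutionOn.density_nonneg (hlam : 0 < lam) (hf0 : ∀ j, f j 0 = 0) {J : Set ℝ}
    (hJ : Convex ℝ J) {x r : ℝ → Fin p → ℝ}
    (h : IsSolutionOn lam eta f u J x r) {s : ℝ} (hs : s ∈ J) (hJs : ∀ t ∈ J, s ≤ t)
    (hr : r s ∈ stdSimplex ℝ (Fin p)) (hx : ∀ j, 0 ≤ x s j) {t : ℝ} (ht : t ∈ J) (j : Fin p) :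
    0 ≤ x t j := by
  have h1 := le_mul_exp_of_hasDerivWithinAt_le hJ (c := 0)
    (fun t ht => (hasDerivAt_sq_posPart (-x t j)).comp_hasDerivWithinAt t (h t ht j).1.fun_neg)
    (fun t ht => by
      rw [zero_mul]
      rcases le_total 0 (x t j) with h0 | h0
      · simp [max_eq_right (neg_nonpos.2 h0)]
      · have hrj := (h.routing_mem_stdSimplex hJ hs ht (hJs t ht) hr).1 j
        simp only [densityRate, max_eq_right h0, hf0, max_eq_left (neg_nonneg.2 h0)]
        nlinarith [mul_nonneg hlam.le hrj, mul_nonneg (mul_nonneg hlam.le hrj) (neg_nonneg.2 h0)])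
    hs ht (hJs t ht)
  simp only [Function.comp_apply, max_eq_right (neg_nonpos.2 (hx j))] at h1
  have h2 : max (-x t j) 0 = 0 := by
    refine pow_eq_zero_iff two_ne_zero |>.1 (le_antisymm ?_ (sq_nonneg _))
    simpa using h1
  linarith [le_max_left (-x t j) 0]

/-- As long as the densities stay in a small neighbourhood of the free-flow region, the squared
distance to the upper bounds grows at most exponentially. -/
theorem IsSolutionOn.upper_bounds_of_near (hlam : 0 < lam) (heta : 0 ≤ eta)
    (hxbar : ∀ j, 0 < xbar j)
    (hbounds : ∀ j, ∀ y ∈ Set.Icc 0 (xbar j), ulow j ≤ u j y ∧ u j y ≤ uhigh j)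
    (hexist : ∀ j, lam ≤
      f j (xbar j) * Real.exp (eta * ulow j) * ∑ i, Real.exp (-eta * uhigh i))
    {K : ℝ} {ε : Fin p → ℝ} (hK : 0 ≤ K)
    (hKf : ∀ j y, xbar j ≤ y → y ≤ xbar j + ε j → |f j y - f j (xbar j)| ≤ K * (y - xbar j))
    (hKu : ∀ j y, xbar j ≤ y → y ≤ xbar j + ε j → |u j y - u j (xbar j)| ≤ K * (y - xbar j))
    {J : Set ℝ} (hJ : Convex ℝ J) {x r : ℝ → Fin p → ℝ}
    (h : IsSolutionOn lam eta f u J x r) (hx0 : ∀ t ∈ J, ∀ j, 0 ≤ x t j)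
    (hxε : ∀ t ∈ J, ∀ j, x t j ≤ xbar j + ε j) {s t : ℝ} (hs : s ∈ J) (ht : t ∈ J) (hst : s ≤ t)
    (hxs : ∀ j, x s j ≤ xbar j) (hrs : ∀ j, r s j ≤ f j (xbar j) / lam) :
    (∀ j, x t j ≤ xbar j) ∧ ∀ j, r t j ≤ f j (xbar j) / lam := by
  set V : ℝ → ℝ := fun t => ∑ j, max (x t j - xbar j) 0 ^ 2 +
    ∑ j, max (r t j - f j (xbar j) / lam) 0 ^ 2 with hVdef
  set V' : ℝ → ℝ := fun t =>
    ∑ j, 2 * max (x t j - xbar j) 0 * densityRate lam f (x t) (r t) j +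
    ∑ j, 2 * max (r t j - f j (xbar j) / lam) 0 * routingRate eta u (x t) (r t) j
  have hV : ∀ t ∈ J, HasDerivWithinAt V (V' t) J t := fun t ht =>
    (HasDerivWithinAt.fun_sum fun j _ =>
      (hasDerivAt_sq_posPart _).comp_hasDerivWithinAt t ((h t ht j).1.sub_const (xbar j))).fun_add
    (HasDerivWithinAt.fun_sum fun j _ =>
      (hasDerivAt_sq_posPart _).comp_hasDerivWithinAt t
        ((h t ht j).2.sub_const (f j (xbar j) / lam)))
  -- Density terms contribute `(2K + λ)|y|² + λ|w|²`, routing terms `|w|² + (η²K²/4)|y|²`; the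
  -- constant is the sum of all these coefficients.
  have hc : ∀ t ∈ J, V' t ≤ (2 * K + lam + 1 + eta ^ 2 * K ^ 2 / 4) * V t := by
    intro t ht
    set y : Fin p → ℝ := fun j => max (x t j - xbar j) 0 with hy
    set w : Fin p → ℝ := fun j => max (r t j - f j (xbar j) / lam) 0 with hw
    -- `q` projects `x t` onto the box, where the logit response is admissible. The error `δ` is
    -- linear in the excess `y`.
    set q : Fin p → ℝ := fun j => min (x t j) (xbar j) with hq
    have hqX : q ∈ freeFlow xbar := fun j => ⟨le_min (hx0 t ht j) (hxbar j).le, min_le_right _ _⟩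
    have hyn : ∀ j, 0 ≤ y j := fun j => le_max_right _ _
    have hwn : ∀ j, 0 ≤ w j := fun j => le_max_right _ _
    set δ : Fin p → ℝ := fun j => logitChoice eta (fun i => u i (x t i)) j -
      logitChoice eta (fun i => u i (q i)) j with hδ
    have hδ2 : ∑ j, δ j ^ 2 ≤ eta ^ 2 * K ^ 2 / 4 * ∑ j, y j ^ 2 := by
      refine (sum_sq_logitChoice_sub_le eta _ _).trans ?_
      rw [show eta ^ 2 * K ^ 2 / 4 = eta ^ 2 / 4 * K ^ 2 by ring, mul_assoc]
      refine mul_le_mul_of_nonneg_left ?_ (by positivity)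
      rw [Finset.mul_sum]
      refine Finset.sum_le_sum fun j _ => ?_
      rw [← mul_pow]
      refine sq_le_sq.2 ?_
      rw [abs_of_nonneg (mul_nonneg hK (hyn j))]
      rcases le_total (x t j) (xbar j) with hle | hle
      · simp only [hq, min_eq_left hle, sub_self, abs_zero]
        exact mul_nonneg hK (hyn j)
      · simp only [hq, hy, min_eq_right hle, max_eq_left (sub_nonneg.2 hle)]
        exact hKu j _ hle (hxε t ht j)
    have h1 : ∀ j, 2 * y j * densityRate lam f (x t) (r t) j ≤
        (2 * K + lam) * y j ^ 2 + lam * w j ^ 2 := fun j => by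
      rcases le_total (x t j) (xbar j) with hle | hle
      · have : y j = 0 := max_eq_right (sub_nonpos.2 hle)
        rw [this]
        have := mul_nonneg hlam.le (sq_nonneg (w j))
        linarith
      · have hyj : y j = x t j - xbar j := max_eq_left (sub_nonneg.2 hle)
        have hfj := neg_le_of_abs_le (hKf j _ hle (hxε t ht j))
        have hwj : lam * (r t j) - f j (xbar j) ≤ lam * w j := by
          have := mul_le_mul_of_nonneg_left (le_max_left (r t j - f j (xbar j) / lam) 0) hlam.le
          rwa [mul_sub, mul_div_cancel₀ _ hlam.ne'] at this
        have hrate : densityRate lam f (x t) (r t) j ≤ K * y j + lam * w j := by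
          rw [densityRate, max_eq_left (hx0 t ht j), hyj]
          linarith
        have := mul_le_mul_of_nonneg_left hrate (hyn j)
        nlinarith [mul_nonneg hlam.le (sq_nonneg (y j - w j))]
    have h2 : ∀ j, 2 * w j * routingRate eta u (x t) (r t) j ≤ w j ^ 2 + δ j ^ 2 := fun j => by
      have hadm : logitChoice eta (fun i => u i (q i)) j ≤ f j (xbar j) / lam := by
        rw [le_div_iff₀ hlam, mul_comm]
        exact lam_mul_logitChoice_le heta hlam hbounds hexist hqX j
      have hrate : w j * routingRate eta u (x t) (r t) j ≤ w j * δ j := by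
        rcases le_total (r t j) (f j (xbar j) / lam) with hle | hle
        · have : w j = 0 := max_eq_right (sub_nonpos.2 hle)
          simp [this]
        · refine mul_le_mul_of_nonneg_left ?_ (hwn j)
          simp only [routingRate, hδ, max_eq_left (hx0 t ht _)]
          linarith
      nlinarith [sq_nonneg (w j - δ j)]
    have hY : 0 ≤ ∑ j, y j ^ 2 := Finset.sum_nonneg fun j _ => sq_nonneg _
    have hW : 0 ≤ ∑ j, w j ^ 2 := Finset.sum_nonneg fun j _ => sq_nonneg _
    have s1 := Finset.sum_le_sum fun j (_ : j ∈ Finset.univ) => h1 j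
    have s2 := Finset.sum_le_sum fun j (_ : j ∈ Finset.univ) => h2 j
    rw [Finset.sum_add_distrib, ← Finset.mul_sum, ← Finset.mul_sum] at s1
    rw [Finset.sum_add_distrib] at s2
    have e1 : V t = ∑ j, y j ^ 2 + ∑ j, w j ^ 2 := rfl
    have e2 : V' t = ∑ j, 2 * y j * densityRate lam f (x t) (r t) j +
      ∑ j, 2 * w j * routingRate eta u (x t) (r t) j := rfl
    rw [e1, e2]
    nlinarith [mul_nonneg hK hW, mul_nonneg (mul_nonneg (sq_nonneg eta) (sq_nonneg K)) hW]
  have hVs : V s = 0 := by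
    simp [hVdef, max_eq_right (sub_nonpos.2 (hxs _)), max_eq_right (sub_nonpos.2 (hrs _))]
  have hVt := le_mul_exp_of_hasDerivWithinAt_le hJ hV hc hs ht hst
  rw [hVs, zero_mul] at hVt
  have hA : 0 ≤ ∑ j, max (x t j - xbar j) 0 ^ 2 := Finset.sum_nonneg fun j _ => sq_nonneg _
  have hB : 0 ≤ ∑ j, max (r t j - f j (xbar j) / lam) 0 ^ 2 :=
    Finset.sum_nonneg fun j _ => sq_nonneg _
  have key : ∀ g : Fin p → ℝ, ∑ j, max (g j) 0 ^ 2 ≤ 0 → ∀ j, g j ≤ 0 := fun g hg j => by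
    have h0 := (Finset.single_le_sum (f := fun j => max (g j) 0 ^ 2)
      (fun j _ => sq_nonneg _) (Finset.mem_univ j)).trans hg
    have h1 := pow_eq_zero_iff two_ne_zero |>.1 (le_antisymm h0 (sq_nonneg _))
    exact (le_max_left _ _).trans h1.le
  simp only [hVdef] at hVt
  exact ⟨fun j => sub_nonpos.1 (key (fun j => x t j - xbar j) (by linarith) j),
    fun j => sub_nonpos.1 (key (fun j => r t j - f j (xbar j) / lam) (by linarith) j)⟩

theorem IsSolutionOn.mem_of_mem_zero (hlam : 0 < lam) (heta : 0 ≤ eta)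
    (hxbar : ∀ j, 0 < xbar j)
    (hf : ∀ j, OutflowAssumption (f j) (xbar j) (mu j))
    (hu : ∀ j, InformationAssumption (u j) (xbar j) (l j))
    (hbounds : ∀ j, ∀ y ∈ Set.Icc 0 (xbar j), ulow j ≤ u j y ∧ u j y ≤ uhigh j)
    (hexist : ∀ j, lam ≤
      f j (xbar j) * Real.exp (eta * ulow j) * ∑ i, Real.exp (-eta * uhigh i))
    {T : ℝ} {x r : ℝ → Fin p → ℝ} (h : IsSolutionOn lam eta f u (Set.Ico 0 T) x r)
    (hx : x 0 ∈ freeFlow xbar) (hr : r 0 ∈ admissibleRouting lam f xbar)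
    {t : ℝ} (ht : t ∈ Set.Ico 0 T) :
    x t ∈ freeFlow xbar ∧ r t ∈ admissibleRouting lam f xbar := by
  choose εf hεf Kf hKf hf' using fun j => (hf j).exists_linear_bound (hxbar j)
  choose εu hεu Ku hKu hu' using fun j => (hu j).exists_linear_bound (hxbar j)
  set K := ∑ j, (Kf j + Ku j)
  have hK : ∀ j, Kf j + Ku j ≤ K := fun j => Finset.single_le_sum (f := fun j => Kf j + Ku j)
    (fun i _ => add_nonneg (hKf i) (hKu i)) (Finset.mem_univ j)
  have hK0 : 0 ≤ K := Finset.sum_nonneg fun i _ => add_nonneg (hKf i) (hKu i)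
  have hT0 : (0 : ℝ) ∈ Set.Ico 0 T := ⟨le_rfl, ht.1.trans_lt ht.2⟩
  have hsimp : ∀ t ∈ Set.Ico 0 T, r t ∈ stdSimplex ℝ (Fin p) := fun t ht =>
    h.routing_mem_stdSimplex (convex_Ico 0 T) hT0 ht ht.1 hr.1
  have hx0 : ∀ t ∈ Set.Ico 0 T, ∀ j, 0 ≤ x t j := fun t ht j =>
    h.density_nonneg hlam (fun j => (hf j).2.2.2) (convex_Ico 0 T) hT0 (fun t ht => ht.1) hr.1
      (fun j => (hx j).1) ht j
  suffices hup : (∀ j, x t j ≤ xbar j) ∧ ∀ j, r t j ≤ f j (xbar j) / lam from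
    ⟨fun j => ⟨hx0 t ht j, hup.1 j⟩, hsimp t ht, hup.2⟩
  set A : Set ℝ := {s | (∀ j, x s j ≤ xbar j) ∧ ∀ j, r s j ≤ f j (xbar j) / lam} with hA
  have hsub : Set.Icc 0 t ⊆ Set.Ico 0 T := Set.Icc_subset_Ico_right ht.2
  have ht' := h.mono hsub
  have hxc : ContinuousOn x (Set.Icc 0 t) := fun s hs => ht'.continuousWithinAt_fst hs
  have hrc : ContinuousOn r (Set.Icc 0 t) := fun s hs => ht'.continuousWithinAt_snd hs
  have hclosed : IsClosed (A ∩ Set.Icc 0 t) := by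
    have hC : IsClosed {q : (Fin p → ℝ) × (Fin p → ℝ) |
        (∀ j, q.1 j ≤ xbar j) ∧ ∀ j, q.2 j ≤ f j (xbar j) / lam} := by
      refine (isClosed_iInter fun j => ?_).inter (isClosed_iInter fun j => ?_) |> fun h => by
        simpa only [Set.ofPred_and, Set.ofPred_forall] using h
      · exact isClosed_le (by fun_prop) continuous_const
      · exact isClosed_le (by fun_prop) continuous_const
    have := (hxc.prodMk hrc).preimage_isClosed_of_isClosed isClosed_Icc hC
    rwa [Set.inter_comm] at this
  -- Continuous induction: from a time where the bounds hold, continuity keeps `x` near the box for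
  -- a while, and the local estimate propagates the bounds.
  refine hclosed.Icc_subset_of_forall_exists_gt ⟨fun j => (hx j).2, hr.2⟩ ?_ ⟨ht.1, le_rfl⟩
  rintro s ⟨hsA, hs⟩ b hb
  have hsT : s ∈ Set.Icc 0 t := ⟨hs.1, hs.2.le⟩
  have hnear : ∀ᶠ τ in nhdsWithin s (Set.Icc 0 t), ∀ j, x τ j < xbar j + min (εf j) (εu j) := by
    refine Filter.eventually_all.2 fun j => ?_
    have hc := (ht' s hsT j).1.continuousWithinAt
    refine hc.eventually (gt_mem_nhds ?_)
    linarith [hsA.1 j, lt_min (hεf j) (hεu j)]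
  obtain ⟨d, hd, hball⟩ := Metric.mem_nhdsWithin_iff.1 hnear
  set e := min (min b t) (s + d / 2) with he
  have hse : s < e := lt_min (lt_min hb hs.2) (by linarith)
  have hJ : Set.Icc s e ⊆ Set.Icc 0 t := Set.Icc_subset_Icc hs.1
    ((min_le_left _ _).trans (min_le_right _ _))
  refine ⟨e, ?_, hse, (min_le_left _ _).trans (min_le_left _ _)⟩
  refine (ht'.mono hJ).upper_bounds_of_near (ε := fun j => min (εf j) (εu j)) hlam heta hxbar
    hbounds hexist hK0 (fun j y hy hy' => ?_) (fun j y hy hy' => ?_) (convex_Icc s e)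
    (fun τ hτ => hx0 τ (hsub (hJ hτ))) (fun τ hτ j => ?_) (Set.left_mem_Icc.2 hse.le)
    (Set.right_mem_Icc.2 hse.le) hse.le hsA.1 hsA.2
  · exact (hf' j y hy (hy'.trans (by gcongr; exact min_le_left _ _))).trans
      (mul_le_mul_of_nonneg_right (by linarith [hK j, hKu j]) (sub_nonneg.2 hy))
  · exact (hu' j y hy (hy'.trans (by gcongr; exact min_le_right _ _))).trans
      (mul_le_mul_of_nonneg_right (by linarith [hK j, hKf j]) (sub_nonneg.2 hy))
  · refine (hball ⟨?_, hJ hτ⟩ j).le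
    rw [Metric.mem_ball, Real.dist_eq, abs_of_nonneg (by linarith [hτ.1])]
    linarith [hτ.2, min_le_right (min b t) (s + d / 2)]

end

/-! ### Exponential decay of a weighted squared distance to the equilibrium. -/

section

variable {p : ℕ} {lam eta : ℝ} {xbar : Fin p → ℝ} {f u : Fin p → ℝ → ℝ}
  {mu l : Fin p → ℝ} {L m : ℝ}

theorem tendsto_of_tendsto_sum_sq_sub {x : ℝ → Fin p → ℝ} {a : Fin p → ℝ}
    (h : Filter.Tendsto (fun t => ∑ j, (x t j - a j) ^ 2) Filter.atTop (nhds 0)) :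
    Filter.Tendsto x Filter.atTop (nhds a) := by
  refine tendsto_pi_nhds.2 fun j => ?_
  have h1 : Filter.Tendsto (fun t => (x t j - a j) ^ 2) Filter.atTop (nhds 0) :=
    squeeze_zero (fun t => sq_nonneg _) (fun t => Finset.single_le_sum
      (f := fun j => (x t j - a j) ^ 2) (fun j _ => sq_nonneg _) (Finset.mem_univ j)) h
  have h2 := h1.sqrt
  simp only [Real.sqrt_sq_eq_abs, Real.sqrt_zero] at h2
  exact tendsto_sub_nhds_zero_iff.1 (tendsto_zero_iff_abs_tendsto_zero _ |>.2 h2)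

variable [NeZero p]

theorem IsSolutionOn.tendsto_of_mem_freeFlow (hlam : 0 < lam) (heta : 0 ≤ eta)
    (hf : ∀ j, OutflowAssumption (f j) (xbar j) (mu j))
    (hu : ∀ j, InformationAssumption (u j) (xbar j) (l j)) (hm : ∀ j, m ≤ mu j)
    (hl : ∀ j, l j ≤ L) (hL : 0 ≤ L) (hstab : lam * eta * L < 2 * m)
    {xeq req : Fin p → ℝ} (hxeq : xeq ∈ freeFlow xbar)
    (heq : IsEquilibrium lam eta f u xeq req) {x r : ℝ → Fin p → ℝ}
    (h : IsSolutionOn lam eta f u (Set.Ici 0) x r) (hx : ∀ t, 0 ≤ t → x t ∈ freeFlow xbar) :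
    Filter.Tendsto (fun t => (x t, r t)) Filter.atTop (nhds (xeq, req)) := by
  rw [isEquilibrium_iff_of_mem_freeFlow hxeq] at heq
  set k := eta * L / 2 with hk
  have hk0 : 0 ≤ k := by positivity
  -- Strictness on the left keeps `κ` positive even if `η L = 0`.
  obtain ⟨κ, hkκ, hκ⟩ : ∃ κ, k < κ ∧ κ < m / lam :=
    exists_between ((lt_div_iff₀ hlam).2 (by rw [hk]; linarith))
  have hκ0 : 0 < κ := hk0.trans_lt hkκ
  rw [lt_div_iff₀ hlam] at hκ
  have hm0 : 0 < m := lt_trans (mul_pos hκ0 hlam) hκ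
  -- `θ` is the Young parameter. Adding the two estimates gives `V' ≤ -2κ(m - λκ/θ) X - 2λ(1 - θ)
  -- R`, and both coefficients are negative exactly when `κλ/m < θ < 1`.
  obtain ⟨θ, hθ, hθ1⟩ : ∃ θ, κ * lam / m < θ ∧ θ < 1 := exists_between ((div_lt_one hm0).2 hκ)
  have hθ0 : 0 < θ := (div_pos (mul_pos hκ0 hlam) hm0).trans hθ
  have hgap : 0 < m - lam * κ / θ := by
    rw [sub_pos, div_lt_iff₀ hθ0]
    rw [div_lt_iff₀ hm0] at hθ
    linarith
  set c := min (m - lam * κ / θ) (1 - θ) with hc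
  have hc0 : 0 < c := lt_min hgap (by linarith)
  set V : ℝ → ℝ := fun t => κ * ∑ j, (x t j - xeq j) ^ 2 + lam * ∑ j, (r t j - req j) ^ 2
    with hVdef
  set V' : ℝ → ℝ := fun t =>
    κ * ∑ j, 2 * (x t j - xeq j) * densityRate lam f (x t) (r t) j +
      lam * ∑ j, 2 * (r t j - req j) * routingRate eta u (x t) (r t) j
  have hV : ∀ t ∈ Set.Ici (0 : ℝ), HasDerivWithinAt V (V' t) (Set.Ici 0) t := fun t ht =>
    ((HasDerivWithinAt.fun_sum fun j _ =>
      ((((h t ht j).1.sub_const (xeq j)).fun_pow 2).congr_deriv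
        (by simp))).const_mul κ).fun_add
    ((HasDerivWithinAt.fun_sum fun j _ =>
      ((((h t ht j).2.sub_const (req j)).fun_pow 2).congr_deriv
        (by simp))).const_mul lam)
  have hdecay : ∀ t ∈ Set.Ici (0 : ℝ), V' t ≤ -(2 * c) * V t := by
    intro t ht
    set δ : Fin p → ℝ := fun j => logitChoice eta (fun i => u i (x t i)) j -
      logitChoice eta (fun i => u i (xeq i)) j with hδ
    set X := ∑ j, (x t j - xeq j) ^ 2 with hX
    set R := ∑ j, (r t j - req j) ^ 2 with hR
    have hX0 : 0 ≤ X := Finset.sum_nonneg fun j _ => sq_nonneg _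
    have hR0 : 0 ≤ R := Finset.sum_nonneg fun j _ => sq_nonneg _
    have hδ2 : ∑ j, δ j ^ 2 ≤ κ ^ 2 * X :=
      (sum_sq_logitChoice_info_sub_le hu hl (hx t ht) hxeq).trans
        (mul_le_mul_of_nonneg_right (pow_le_pow_left₀ hk0 hkκ.le 2) hX0)
    have young : ∀ a b : ℝ, 2 * a * b ≤ θ * b ^ 2 + a ^ 2 / θ := fun a b => by
      have e : θ * b ^ 2 + a ^ 2 / θ - 2 * a * b = (θ * b - a) ^ 2 / θ := by
        field_simp
        ring
      have := div_nonneg (sq_nonneg (θ * b - a)) hθ0.le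
      linarith
    have h1 : ∀ j, κ * (2 * (x t j - xeq j) * densityRate lam f (x t) (r t) j) ≤
        (-(2 * κ * m) + lam * κ ^ 2 / θ) * (x t j - xeq j) ^ 2 +
          lam * θ * (r t j - req j) ^ 2 := fun j => by
      have hmono := (hf j).2.2.1 _ (hx t ht j) _ (hxeq j)
      have hmono' := (mul_le_mul_of_nonneg_right (hm j) (sq_nonneg (x t j - xeq j))).trans hmono
      have hy := mul_le_mul_of_nonneg_left (young (κ * (x t j - xeq j)) (r t j - req j)) hlam.le
      have e : densityRate lam f (x t) (r t) j =
          -(f j (x t j) - f j (xeq j)) + lam * (r t j - req j) := by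
        rw [densityRate, max_eq_left (hx t ht j).1, (heq j).1]
        ring
      have e2 : lam * ((κ * (x t j - xeq j)) ^ 2 / θ) =
          lam * κ ^ 2 / θ * (x t j - xeq j) ^ 2 := by ring
      rw [e]
      nlinarith [mul_le_mul_of_nonneg_left hmono' hκ0.le]
    have h2 : ∀ j, 2 * (r t j - req j) * routingRate eta u (x t) (r t) j ≤
        -(2 - θ) * (r t j - req j) ^ 2 + δ j ^ 2 / θ := fun j => by
      have e : routingRate eta u (x t) (r t) j = -(r t j - req j) + δ j := by
        simp only [routingRate, max_eq_left (hx t ht _).1, hδ, (heq j).2]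
        ring
      rw [e]
      linarith [young (δ j) (r t j - req j)]
    have s1 := Finset.sum_le_sum fun j (_ : j ∈ Finset.univ) => h1 j
    have s2 := Finset.sum_le_sum fun j (_ : j ∈ Finset.univ) => h2 j
    rw [Finset.sum_add_distrib, ← Finset.mul_sum, ← Finset.mul_sum, ← Finset.mul_sum, ← hX,
      ← hR] at s1
    rw [Finset.sum_add_distrib, ← Finset.mul_sum, ← Finset.sum_div, ← hR] at s2
    have s3 := (div_le_div_iff_of_pos_right hθ0).2 hδ2
    have s4 := mul_le_mul_of_nonneg_left (s2.trans (add_le_add_right s3 _)) hlam.le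
    have e1 : lam * (κ ^ 2 * X / θ) = κ * (lam * κ / θ) * X := by ring
    have e2 : lam * κ ^ 2 / θ * X = κ * (lam * κ / θ) * X := by ring
    have b1 := mul_le_mul_of_nonneg_right (min_le_left (m - lam * κ / θ) (1 - θ))
      (mul_nonneg hκ0.le hX0)
    have b2 := mul_le_mul_of_nonneg_right (min_le_right (m - lam * κ / θ) (1 - θ))
      (mul_nonneg hlam.le hR0)
    rw [← hc] at b1 b2
    show κ * _ + lam * _ ≤ -(2 * c) * (κ * X + lam * R)
    linarith
  have hVlim : Filter.Tendsto V Filter.atTop (nhds 0) := by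
    have hlim : Filter.Tendsto (fun t => V 0 * Real.exp (-(2 * c) * (t - 0))) Filter.atTop
        (nhds 0) := by
      have h1 : Filter.Tendsto (fun t : ℝ => -(2 * c) * (t - 0)) Filter.atTop Filter.atBot := by
        simp only [sub_zero]
        exact Filter.tendsto_id.const_mul_atTop_of_neg (by linarith)
      simpa using (Real.tendsto_exp_atBot.comp h1).const_mul (V 0)
    refine tendsto_of_tendsto_of_tendsto_of_le_of_le' tendsto_const_nhds hlim
      (Filter.Eventually.of_forall fun t => by positivity) ?_
    filter_upwards [Filter.eventually_ge_atTop 0] with t ht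
    exact le_mul_exp_of_hasDerivWithinAt_le (convex_Ici 0) hV hdecay Set.self_mem_Ici ht ht
  have hXR : ∀ t, 0 ≤ ∑ j, (x t j - xeq j) ^ 2 ∧ 0 ≤ ∑ j, (r t j - req j) ^ 2 := fun t =>
    ⟨Finset.sum_nonneg fun j _ => sq_nonneg _, Finset.sum_nonneg fun j _ => sq_nonneg _⟩
  refine Filter.Tendsto.prodMk_nhds (tendsto_of_tendsto_sum_sq_sub ?_)
    (tendsto_of_tendsto_sum_sq_sub ?_)
  · refine squeeze_zero (fun t => (hXR t).1) (fun t => ?_) (by simpa using hVlim.div_const κ)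
    rw [le_div_iff₀ hκ0, mul_comm]
    exact le_add_of_nonneg_right (mul_nonneg hlam.le (hXR t).2)
  · refine squeeze_zero (fun t => (hXR t).2) (fun t => ?_) (by simpa using hVlim.div_const lam)
    rw [le_div_iff₀ hlam, mul_comm]
    exact le_add_of_nonneg_left (mul_nonneg hκ0.le (hXR t).1)

end

theorem corollary1 (p : ℕ) [NeZero p] (lam eta : ℝ) (hlam : 0 < lam) (heta : 0 ≤ eta)
    (xbar : Fin p → ℝ) (hxbar : ∀ j, 0 < xbar j)
    (f u : Fin p → ℝ → ℝ) (mu l ulow uhigh : Fin p → ℝ)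
    (hf : ∀ j, OutflowAssumption (f j) (xbar j) (mu j))
    (hu : ∀ j, InformationAssumption (u j) (xbar j) (l j))
    (hbounds : ∀ j, ∀ y ∈ Set.Icc 0 (xbar j), ulow j ≤ u j y ∧ u j y ≤ uhigh j)
    (hexist : ∀ j, lam ≤
      f j (xbar j) * Real.exp (eta * ulow j) * ∑ i, Real.exp (-eta * uhigh i))
    (hstab : lam * eta * (⨆ j, l j) < 2 * (⨅ j, mu j)) :
    -- every solution that starts in `X × R'`, on any time interval `[0, T)`, stays in `X × R'`
    (∀ (T : ℝ) (x r : ℝ → Fin p → ℝ), 0 < T →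
      IsSolutionOn lam eta f u (Set.Ico 0 T) x r →
      x 0 ∈ freeFlow xbar → r 0 ∈ admissibleRouting lam f xbar →
      ∀ t ∈ Set.Ico 0 T, x t ∈ freeFlow xbar ∧ r t ∈ admissibleRouting lam f xbar) ∧
    -- there is exactly one free-flow equilibrium; it lies in `X × R'` and attracts all solutions
    -- on `[0, ∞)` that start in `X × R'`, which stay there
    ∃ (xeq req : Fin p → ℝ),
      xeq ∈ freeFlow xbar ∧ req ∈ admissibleRouting lam f xbar ∧
      IsEquilibrium lam eta f u xeq req ∧
      (∀ y s : Fin p → ℝ, y ∈ freeFlow xbar → s ∈ stdSimplex ℝ (Fin p) →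
        IsEquilibrium lam eta f u y s → y = xeq ∧ s = req) ∧
      ∀ x r : ℝ → Fin p → ℝ,
        IsSolutionOn lam eta f u (Set.Ici 0) x r →
        x 0 ∈ freeFlow xbar → r 0 ∈ admissibleRouting lam f xbar →
        (∀ t, 0 ≤ t → x t ∈ freeFlow xbar ∧ r t ∈ admissibleRouting lam f xbar) ∧
        Filter.Tendsto (fun t => (x t, r t)) Filter.atTop (nhds (xeq, req)) := by

  have hl : ∀ j, l j ≤ ⨆ j, l j := le_ciSup (Set.finite_range l).bddAbove
  have hm : ∀ j, ⨅ j, mu j ≤ mu j := ciInf_le (Set.finite_range mu).bddBelow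
  have hL : 0 ≤ ⨆ j, l j := (hu 0).2.2.1.trans (hl 0)
  have hpos : 0 ≤ lam * eta * ⨆ j, l j := mul_nonneg (mul_nonneg hlam.le heta) hL
  have hinv : ∀ (T : ℝ) (x r : ℝ → Fin p → ℝ), IsSolutionOn lam eta f u (Set.Ico 0 T) x r →
      x 0 ∈ freeFlow xbar → r 0 ∈ admissibleRouting lam f xbar →
      ∀ t ∈ Set.Ico 0 T, x t ∈ freeFlow xbar ∧ r t ∈ admissibleRouting lam f xbar :=
    fun T x r h hx hr t ht => h.mem_of_mem_zero hlam heta hxbar hf hu hbounds hexist hx hr ht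
  refine ⟨fun T x r _ => hinv T x r, ?_⟩
  obtain ⟨xeq, hxeq, req, hreq, heq⟩ :=
    exists_isEquilibrium hlam heta hxbar hf hu hbounds hexist hm hl hpos hstab
  refine ⟨xeq, req, hxeq, hreq, heq,
    fun y s hy _ hys => heq.unique hf hu hm hl hpos hstab hxeq hy hys, fun x r h hx hr => ?_⟩
  have hstay : ∀ t, 0 ≤ t → x t ∈ freeFlow xbar ∧ r t ∈ admissibleRouting lam f xbar :=
    fun t ht => hinv (t + 1) x r (h.mono Set.Ico_subset_Ici_self) hx hr t ⟨ht, lt_add_one t⟩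
  exact ⟨hstay, h.tendsto_of_mem_freeFlow hlam heta hf hu hm hl hL hstab hxeq heq
    fun t ht => (hstay t ht).1⟩
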